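/- **Setting.** The congested clique on $n\ge 1$ nodes $V$ is the synchronous model in which in every round each node sends to every other node its own message of $O(\log n)$ bits; local computation is unrestricted. A family $\mathcal H$ of functions $h:[N]\to[M]$ is *$k$-wise independent* if, for $h$ drawn uniformly from $\mathcal H$, each $h(a)$ is uniform on $[M]$ and any at most $k$ of the values $h(a)$ are independent. We consider families with $n\le N\le n^{c}$, $n\le M\le n^{c}$ and $|\mathcal H|\le n^{c}$ (counted with multiplicity) for a constant $c$, so that a member is specified by $O(\log n)$ bits; nodes are identified with elements of $[n]\subseteq[N]$. Let $G_1$ be a graph with $V(G_1)\subseteq V$, where each node $v$ of $G_1$ has a color palette $\Psi(v)$ of size $p(v)\ge d(v)+1$, with $d=d_{G_1}$; initially node $v$ knows whether $v\in G_1$, its neighbors in $G_1$, and $\Psi(v)$. Let $C$ be a constant. The procedure Subsample run with $h\in\mathcal H$ does the following. 1. Node $v$ of $G_1$ joins $S$ iff $h(v)\le M\,d(v)^{-0.1}$, i.e. with probability $d(v)^{-0.1}$ up to the granularity $1/M$ (an isolated node always joins). 2. A node $v$ of $G_1$ is *failed* if $p(v)<1.1\,d(v)$, more than $\frac13 d(v)$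 neighbors $u$ of $v$ satisfy $\frac12 d(v)\le d(u)\le 6d(v)$, and fewer than $\frac14 p(v)^{0.9}$ neighbors of $v$ are in $S$. Let $F_1$ be the set of failed nodes, and $L$ the set of nodes $v$ of $G_1$ with $p(v)<C$. 3. The deferred graph $G'$ is the subgraph of $G_1$ induced by $S\cup F_1\cup L$. **Statement.** There is a constant $c$ such that for every $n\ge1$ there is a 101-wise independent family with the above sizes. Moreover, there is an absolute constant $C_0$ such that for every $c$ there are constants $B$ and $R$, depending only on $c$, with the following property. For all $n\ge1$, all $0\le x\le 0.9$, all $C\ge C_0$ and every 101-wise independent family $\mathcal H$ with the above sizes, there is a deterministic congested clique algorithm with messages of $B\lceil\log_2 n\rceil$ bits which, on every such $G_1$ with palettes, after $R$ rounds has every network node output the same function $h\in\mathcal H$, and with this choice the deferred graph $G'$ of Subsample satisfies $$\sum_{v\in G'} d_{G_1}(v)^{x+0.1}\;\le\; Cn+2\sum_{v\in G_1} d_{G_1}(v)^{x}$$ (with $0^0=1$). -/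

import Mathlib

/-! ## Bounded-independence hash families -/

/-- `hashProb H P`: the probability that `H σ` satisfies `P` when the function `H σ` is drawn
uniformly at random from the (indexed) family `H` of `s` functions `Fin N → Fin M`. -/
noncomputable def hashProb {s N M : ℕ} (H : Fin s → Fin N → Fin M)
    (P : (Fin N → Fin M) → Prop) : ℝ :=
  open Classical in
  ((Finset.univ.filter fun σ : Fin s => P (H σ)).card : ℝ) / (s : ℝ)

/-- A `k`-wise independent hash family: for a uniformly random member `h`, every value `h a` is
uniformly distributed on the range, and any at most `k` of the values `h a` are independent. -/
def IsKWiseIndependent (k : ℕ) {s N M : ℕ} (H : Fin s → Fin N → Fin M) : Prop :=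
  (∀ (a : Fin N) (y : Fin M), hashProb H (fun h => h a = y) = 1 / (M : ℝ)) ∧
  ∀ I : Finset (Fin N), I.card ≤ k → ∀ y : Fin N → Fin M,
    hashProb H (fun h => ∀ a ∈ I, h a = y a) = ∏ a ∈ I, hashProb H (fun h => h a = y a)

/-- The size conventions for a hash family used in a network of `n` nodes: domain and range are
`[n^{O(1)}]`, both of size at least `n`, and the family has at most `n^c` members, so that a member
is specified by `O(log n)` bits. The exponent hidden in the `O(1)` is bounded by `c`. -/
structure HashSizes (c n s N M : ℕ) : Prop where
  le_domain : n ≤ N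
  domain_le : N ≤ n ^ c
  le_range : n ≤ M
  range_le : M ≤ n ^ c
  size_le : s ≤ n ^ c

/-! ## The congested clique -/

/-- A deterministic algorithm in the congested clique on the `n` network nodes `Fin n`. In each
synchronous round, every node sends to every node its own message of `b` bits. Local computation is
unrestricted. -/
structure CliqueAlgorithm (n b : ℕ) (Input : Type*) (Output : Type*) where
  /-- local memory of a node -/
  State : Type
  /-- initial memory of a node, from its identifier and its own input -/
  init : Fin n → Input → State
  /-- message sent to the given recipient -/
  send : State → Fin n → (Fin b → Bool)
  /-- new memory, from the old one and the messages received, indexed by their sender -/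
  receive : State → (Fin n → (Fin b → Bool)) → State
  /-- output of a node -/
  output : State → Output

namespace CliqueAlgorithm

variable {n b : ℕ} {Input Output : Type*}

/-- One communication round. -/
def step (A : CliqueAlgorithm n b Input Output) (st : Fin n → A.State) : Fin n → A.State :=
  fun v => A.receive (st v) (fun u => A.send (st u) v)

/-- Outputs of all nodes after `R` rounds, where node `v` has input `inp v`. -/
def run (A : CliqueAlgorithm n b Input Output) (R : ℕ) (inp : Fin n → Input) : Fin n → Output :=
  fun v => A.output (A.step^[R] (fun u => A.init u (inp u)) v)

end CliqueAlgorithm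

/-! ## Graphs with palettes -/

/-- What a network node knows initially: whether its graph node is in the current graph, the
neighbors of the graph node there, and its palette. -/
structure NodeInput (n : ℕ) (Color : Type*) where
  active : Prop
  neighbors : Finset (Fin n)
  palette : Finset Color

/-- A current graph, with vertex set contained in the `n` nodes `Fin n`, whose nodes have color
palettes with more colors than the degree. -/
structure PaletteGraph (n : ℕ) (Color : Type*) where
  verts : Finset (Fin n)
  graph : SimpleGraph (Fin n)
  mem_of_adj : ∀ u v, graph.Adj u v → u ∈ verts
  palette : Fin n → Finset Color
  degree_lt : ∀ v ∈ verts, (graph.neighborSet v).ncard + 1 ≤ (palette v).card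

namespace PaletteGraph

variable {n : ℕ} {Color : Type*} (G : PaletteGraph n Color)

/-- The set of neighbors of `v`. -/
noncomputable def nbr (v : Fin n) : Finset (Fin n) :=
  open Classical in Finset.univ.filter fun u => G.graph.Adj v u

/-- The degree `d(v)`. -/
noncomputable def deg (v : Fin n) : ℕ := (G.nbr v).card

/-- The palette size `p(v)`. -/
def pal (v : Fin n) : ℕ := (G.palette v).card

/-- The input of the network node `v`. -/
noncomputable def nodeInput (v : Fin n) : NodeInput n Color where
  active := v ∈ G.verts
  neighbors := G.nbr v
  palette := G.palette v

/-! ### The procedure Subsample -/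

/-- The probability `d(v)^{-0.1}` with which `v` is to be sampled (`1` for an isolated node). -/
noncomputable def sampleProb (v : Fin n) : ℝ :=
  if G.deg v = 0 then 1 else (G.deg v : ℝ) ^ (-0.1 : ℝ)

/-- The set `S` sampled when the choices are made by the hash function `h`: with the range read as
`{1, …, M}`, node `v` joins iff `h v ≤ M * d(v)^{-0.1}`. (An element `y : Fin M` stands for the
value `y + 1`.) -/
noncomputable def sampled {N M : ℕ} (hN : n ≤ N) (h : Fin N → Fin M) : Finset (Fin n) :=
  open Classical in
  G.verts.filter fun v => ((h (Fin.castLE hN v)).val : ℝ) + 1 ≤ (M : ℝ) * G.sampleProb v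

/-- The neighbors `u` of `v` with `d(v)/2 ≤ d(u) ≤ 6 d(v)`. -/
noncomputable def similarNbr (v : Fin n) : Finset (Fin n) :=
  open Classical in
  (G.nbr v).filter fun u =>
    (1 / 2 : ℝ) * (G.deg v : ℝ) ≤ (G.deg u : ℝ) ∧ (G.deg u : ℝ) ≤ 6 * (G.deg v : ℝ)

/-- Node `v` is successful when the set `S` has been sampled. -/
def Successful (S : Finset (Fin n)) (v : Fin n) : Prop :=
  (1.1 : ℝ) * (G.deg v : ℝ) ≤ (G.pal v : ℝ) ∨
  ((G.similarNbr v).card : ℝ) ≤ (1 / 3 : ℝ) * (G.deg v : ℝ) ∨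
  (1 / 4 : ℝ) * (G.pal v : ℝ) ^ (0.9 : ℝ) ≤ ((G.nbr v ∩ S).card : ℝ)

/-- The set `F₁` of failed nodes when the set `S` has been sampled. -/
noncomputable def failed (S : Finset (Fin n)) : Finset (Fin n) :=
  open Classical in G.verts.filter fun v => ¬ G.Successful S v

/-- The set `L` of nodes with palette size less than `C`. -/
noncomputable def small (C : ℝ) : Finset (Fin n) :=
  open Classical in G.verts.filter fun v => (G.pal v : ℝ) < C

/-- The vertex set `S ∪ F₁ ∪ L` of the deferred graph `G'` when the choices are made by `h`. -/
noncomputable def deferred (C : ℝ) {N M : ℕ} (hN : n ≤ N) (h : Fin N → Fin M) :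
    Finset (Fin n) :=
  G.sampled hN h ∪ G.failed (G.sampled hN h) ∪ G.small C

end PaletteGraph

/-!
A hash family: polynomials of degree less than `101` over a prime field whose order `p` satisfies
`n < p ≤ 2 * n`. By Lagrange interpolation, their values at any `101` points are independent.

The good hash function: suppose that a member `h` of the family is drawn at random. Give each node
`v` of the deferred graph the cost `d(v) ^ (x + 0.1)`, rounded up to an integer. Then the expected
cost of every node `v` is at most `C + 2 * d(v) ^ x` (`PaletteGraph.sum_cost_le`). Indeed

* if `d(v) ≤ C`, the cost is at most `d(v)`; in particular this covers the nodes of small palette;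
* otherwise `v` is sampled with probability at most `d(v) ^ (-0.1)`, and it also fails with
  probability at most `d(v) ^ (-0.1)` (`PaletteGraph.card_mem_failed_le`). A node that may fail has
  more than `d(v) / 3` neighbors of degree at most `6 * d(v)`, so that on average about
  `6 ^ (-0.1) / 3 * d(v) ^ 0.9` of them are sampled, or more. This exceeds the threshold
  `p(v) ^ 0.9 / 4 < 1.1 ^ 0.9 / 4 * d(v) ^ 0.9` by a constant multiple of `d(v) ^ 0.9`, while the
  variance is `O(d(v) ^ 0.9)`. Pairwise independence and Chebyshev's inequality give a failure
  probability of `O(d(v) ^ (-0.9))`.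

Derandomization: after one round, in which the degrees are broadcast, each node knows its cost for
every member of the family. As the costs are integers less than `n`, the method of conditional
expectations needs no further rounding (`Computes.exists_le_average`): the index of `h`, a number
with `c` digits in base `n`, is fixed digit by digit, in two rounds each, such that the average
total cost over the remaining indices never increases.

Algorithms are handled through the predicate `Computes`, which says that some algorithm has
prescribed outputs on all instances. A computed value may be replaced by anything that it determines
(`Computes.of_determined`), and a round may be added in which numbers determined by the computed
values are sent (`Computes.exchange`); local computations thus never have to be written down.
-/

/-! ### Polynomial hash families -/

/-- The number of coefficient vectors whose polynomial of degree less than `k` has prescribed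
values on at most `k` points: evaluation is a linear map, onto by Lagrange interpolation, so that
all its fibers have the same size. -/
theorem card_polynomials_with_prescribed_values {F : Type*} [Field F] [Fintype F] [DecidableEq F]
    {k : ℕ} (I : Finset F) (hI : I.card ≤ k) (y : F → F) :
    (Finset.univ.filter fun c : Fin k → F => ∀ a ∈ I, ∑ i, c i * a ^ (i : ℕ) = y a).card *
      Fintype.card F ^ I.card = Fintype.card F ^ k := by
  let L : (Fin k → F) →+ (I → F) :=
    { toFun := fun c a => ∑ i, c i * (a : F) ^ (i : ℕ)
      map_zero' := by ext; simp
      map_add' := fun c d => by ext; simp [add_mul, Finset.sum_add_distrib] }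
  have hsurj : ∀ z : I → F, z ∈ Set.range L := by
    intro z
    let z' : F → F := fun a => if h : a ∈ I then z ⟨a, h⟩ else 0
    let q := Lagrange.interpolate I id z'
    refine ⟨fun i => q.coeff i, ?_⟩
    ext a
    have hinj : Set.InjOn (id : F → F) I := Function.injective_id.injOn
    have hdeg : q.degree < (k : ℕ) :=
      (Lagrange.degree_interpolate_lt z' hinj).trans_le (by exact_mod_cast hI)
    have hev : q.eval (a : F) = z a := by
      have := Lagrange.eval_interpolate_at_node z' hinj a.2
      rw [id] at this
      rw [this]
      simp [z']
    rw [← hev, Polynomial.eval_eq_sum,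
      ← Polynomial.sum_fin (fun i c => c * (a : F) ^ i) (by simp) hdeg]
    rfl
  have hfib : ∀ z : I → F, (Finset.univ.filter fun c => L c = z).card =
      (Finset.univ.filter fun c => L c = fun a : I => y a).card := fun z =>
    AddMonoidHom.card_fiber_eq_of_mem_range L (hsurj z) (hsurj fun a => y a)
  have htot := Finset.card_eq_sum_card_fiberwise (s := (Finset.univ : Finset (Fin k → F)))
    (f := L) (t := Finset.univ) (fun _ _ => by simp)
  rw [Finset.sum_congr rfl fun z _ => hfib z] at htot
  have hset : (Finset.univ.filter fun c : Fin k → F => ∀ a ∈ I, ∑ i, c i * a ^ (i : ℕ) = y a) =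
      Finset.univ.filter fun c => L c = fun a : I => y a := by
    ext c
    simp [L, funext_iff]
  rw [hset]
  simpa [mul_comm] using htot.symm

/-- Polynomials of degree less than `k` over the field with `p` elements form a `k`-wise
independent family. -/
theorem exists_isKWiseIndependent_prime {k : ℕ} (hk : 0 < k) (p : ℕ)
    [Fact p.Prime] : ∃ H : Fin (p ^ k) → Fin p → Fin p, IsKWiseIndependent k H := by
  classical
  let e : Fin (p ^ k) ≃ (Fin k → ZMod p) := (Fintype.equivFinOfCardEq (by simp)).symm
  let j : Fin p ≃ ZMod p := (Fintype.equivFinOfCardEq (by simp)).symm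
  let H : Fin (p ^ k) → Fin p → Fin p := fun σ a => j.symm (∑ i, e σ i * j a ^ (i : ℕ))
  have hp : (p : ℝ) ≠ 0 := by exact_mod_cast (Fact.out : p.Prime).ne_zero
  have key : ∀ I : Finset (Fin p), I.card ≤ k → ∀ y : Fin p → Fin p,
      hashProb H (fun h => ∀ a ∈ I, h a = y a) = (1 / (p : ℝ)) ^ I.card := by
    intro I hI y
    have h := card_polynomials_with_prescribed_values (I.map j.toEmbedding) (k := k)
      (by simpa using hI) (fun a => j (y (j.symm a)))
    have hc : (Finset.univ.filter fun σ => ∀ a ∈ I, H σ a = y a).card =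
        (Finset.univ.filter fun c : Fin k → ZMod p => ∀ a ∈ I.map j.toEmbedding,
          ∑ i, c i * a ^ (i : ℕ) = j (y (j.symm a))).card := by
      refine Finset.card_equiv e fun σ => ?_
      simp only [H, Finset.mem_filter, Finset.mem_univ, true_and, Finset.mem_map_equiv,
        Equiv.symm_apply_eq]
      exact ⟨fun h a ha => by simpa using h _ ha, fun h a ha => by simpa using h (j a) (by simpa)⟩
    rw [← hc] at h
    simp only [Finset.card_map, ZMod.card] at h
    have h' : ((Finset.univ.filter fun σ => ∀ a ∈ I, H σ a = y a).card : ℝ) * (p : ℝ) ^ I.card =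
        (p : ℝ) ^ k := by exact_mod_cast h
    unfold hashProb
    push_cast
    rw [one_div, inv_pow, div_eq_iff (pow_ne_zero _ hp), ← h', mul_comm, mul_assoc,
      mul_inv_cancel₀ (pow_ne_zero _ hp), mul_one]
  have huni : ∀ (a y : Fin p), hashProb H (fun h => h a = y) = 1 / (p : ℝ) := by
    intro a y
    simpa using key {a} (by simpa using Nat.succ_le_of_lt hk) (fun _ => y)
  refine ⟨H, huni, fun I hI y => ?_⟩
  rw [key I hI y]
  simp [huni]

theorem exists_hash_family :
    ∃ c : ℕ, ∀ n : ℕ, 1 ≤ n → ∃ (s N M : ℕ) (H : Fin s → Fin N → Fin M),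
      HashSizes c n s N M ∧ IsKWiseIndependent 101 H := by
  refine ⟨202, fun n hn => ?_⟩
  rcases hn.eq_or_lt with rfl | hn
  · refine ⟨1, 1, 1, fun _ a => a, ⟨by simp, by simp, by simp, by simp, by simp⟩, ?_, ?_⟩
    · intro a y
      simp [hashProb, Subsingleton.elim a y]
    · intro I _ y
      have h (a : Fin 1) : (a = y a) ↔ True := iff_true_intro (Subsingleton.elim _ _)
      simp [hashProb, h]
  · obtain ⟨p, hp, hnp, hpn⟩ := Nat.exists_prime_lt_and_le_two_mul n (by omega)
    have := Fact.mk hp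
    obtain ⟨H, hH⟩ := exists_isKWiseIndependent_prime (k := 101) (by norm_num) p
    have hp2 : p ≤ n ^ 2 := by nlinarith
    have h2 : n ^ 2 ≤ n ^ 202 := Nat.pow_le_pow_right (by omega) (by norm_num)
    refine ⟨p ^ 101, p, p, H, ⟨hnp.le, hp2.trans h2, hnp.le, hp2.trans h2, ?_⟩, hH⟩
    calc p ^ 101 ≤ (n ^ 2) ^ 101 := Nat.pow_le_pow_left hp2 _
      _ = n ^ 202 := by rw [← pow_mul]

/-! ### Second moments under pairwise independence -/

section Hash

variable {k s N M : ℕ} {H : Fin s → Fin N → Fin M}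

theorem IsKWiseIndependent.card_mem (hH : IsKWiseIndependent k H) (hs : 0 < s) (a : Fin N)
    (A : Finset (Fin M)) :
    ((Finset.univ.filter fun σ => H σ a ∈ A).card : ℝ) = s * (A.card / M) := by
  have hs' : (s : ℝ) ≠ 0 := by positivity
  have h1 : ∀ y, ((Finset.univ.filter fun σ => H σ a = y).card : ℝ) = s * (1 / M) := by
    intro y
    rw [← hH.1 a y, hashProb, mul_div_cancel₀ _ hs']
    congr!
  rw [Finset.card_eq_sum_card_fiberwise (f := fun σ => H σ a) (t := A) fun σ hσ => by
    simpa using hσ]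
  push_cast
  rw [Finset.sum_congr rfl (g := fun _ => (s : ℝ) * (1 / M)) fun y hy => ?_]
  · simp
    ring
  · rw [← h1 y, Finset.filter_filter]
    congr 2
    ext σ
    simp only [Finset.mem_filter, Finset.mem_univ, true_and, and_iff_right_iff_imp]
    rintro rfl
    exact hy

theorem IsKWiseIndependent.card_mem_and_mem (hH : IsKWiseIndependent k H) (hk : 2 ≤ k)
    (hs : 0 < s) {a b : Fin N} (hab : a ≠ b) (A B : Finset (Fin M)) :
    ((Finset.univ.filter fun σ => H σ a ∈ A ∧ H σ b ∈ B).card : ℝ) =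
      s * ((A.card / M) * (B.card / M)) := by
  have hs' : (s : ℝ) ≠ 0 := by positivity
  have h1 : ∀ y z, ((Finset.univ.filter fun σ => H σ a = y ∧ H σ b = z).card : ℝ) =
      s * (1 / M * (1 / M)) := by
    intro y z
    have h2 := hH.2 {a, b} (by rwa [Finset.card_pair hab]) fun c => if c = a then y else z
    rw [Finset.prod_pair hab, hH.1, hH.1] at h2
    rw [← h2, hashProb, mul_div_cancel₀ _ hs']
    simp only [Finset.forall_mem_insert, Finset.mem_singleton, forall_eq, if_true,
      if_neg hab.symm]
  rw [Finset.card_eq_sum_card_fiberwise (f := fun σ => (H σ a, H σ b)) (t := A ×ˢ B) fun σ hσ => by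
    simpa using hσ]
  push_cast
  rw [Finset.sum_congr rfl (g := fun _ => (s : ℝ) * (1 / M * (1 / M))) fun y hy => ?_]
  · simp
    ring
  · rw [← h1 y.1 y.2, Finset.filter_filter]
    congr 2
    ext σ
    rw [Finset.mem_product] at hy
    simp only [Finset.mem_filter, Finset.mem_univ, true_and, Prod.ext_iff, and_iff_right_iff_imp]
    rintro ⟨h3, h4⟩
    rw [h3, h4]
    exact hy

end Hash

/-- The variance of a sum of pairwise independent indicators is at most its mean. Here `Ω` carries
the uniform distribution, and `q u` is the probability of `E u`. -/
theorem sum_sq_sub_mean_le {Ω α : Type*} [Fintype Ω] [DecidableEq α] (U : Finset α)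
    (E : α → Ω → Prop) [∀ u, DecidablePred (E u)] (q : α → ℝ)
    (h1 : ∀ u ∈ U, ((Finset.univ.filter (E u)).card : ℝ) = Fintype.card Ω * q u)
    (h2 : ∀ u ∈ U, ∀ w ∈ U, u ≠ w →
      ((Finset.univ.filter fun ω => E u ω ∧ E w ω).card : ℝ) = Fintype.card Ω * (q u * q w)) :
    ∑ ω, (((U.filter fun u => E u ω).card : ℝ) - ∑ u ∈ U, q u) ^ 2 ≤
      Fintype.card Ω * ∑ u ∈ U, q u := by
  let X : α → Ω → ℝ := fun u ω => if E u ω then 1 else 0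
  have hX : ∀ u ∈ U, ∑ ω, X u ω = Fintype.card Ω * q u := by
    intro u hu
    rw [← h1 u hu]
    simp [X]
  have hcov : ∀ u ∈ U, ∀ w ∈ U, ∑ ω, (X u ω - q u) * (X w ω - q w) =
      if u = w then Fintype.card Ω * (q u - q u ^ 2) else 0 := by
    intro u hu w hw
    have h3 : ∑ ω, (X u ω - q u) * (X w ω - q w) =
        ∑ ω, X u ω * X w ω - Fintype.card Ω * (q u * q w) := by
      have h4 : ∀ ω, (X u ω - q u) * (X w ω - q w) =
          X u ω * X w ω - q u * X w ω - q w * X u ω + q u * q w := fun ω => by ring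
      simp only [h4, Finset.sum_add_distrib, Finset.sum_sub_distrib, ← Finset.mul_sum, hX u hu,
        hX w hw, Finset.sum_const, Finset.card_univ, nsmul_eq_mul]
      ring
    have h5 : ∀ ω, X u ω * X w ω = if E u ω ∧ E w ω then 1 else 0 := by
      intro ω
      simp only [X]
      split_ifs <;> simp_all
    rw [h3]
    split_ifs with huw
    · subst huw
      have h6 : ∀ ω, X u ω * X u ω = X u ω := by
        intro ω
        simp only [X]
        split_ifs <;> simp
      rw [Finset.sum_congr rfl fun ω _ => h6 ω, hX u hu]
      ring
    · rw [Finset.sum_congr rfl fun ω _ => h5 ω, ← Finset.natCast_card_filter, h2 u hu w hw huw,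
        sub_self]
  have hexp : ∀ ω, (((U.filter fun u => E u ω).card : ℝ) - ∑ u ∈ U, q u) ^ 2 =
      ∑ u ∈ U, ∑ w ∈ U, (X u ω - q u) * (X w ω - q w) := by
    intro ω
    rw [← Finset.sum_mul_sum, ← sq, Finset.sum_sub_distrib, Finset.natCast_card_filter]
  rw [Finset.sum_congr rfl fun ω _ => hexp ω, Finset.sum_comm, Finset.mul_sum]
  refine Finset.sum_le_sum fun u hu => ?_
  rw [Finset.sum_comm, Finset.sum_congr rfl fun w hw => hcov u hu w hw, Finset.sum_ite_eq,
    if_pos hu]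
  exact mul_le_mul_of_nonneg_left (by nlinarith [sq_nonneg (q u)]) (by positivity)

/-- The hash values, read in `{1, …, M}`, that are at most `M * r`. -/
noncomputable def lowValues (M : ℕ) (r : ℝ) : Finset (Fin M) :=
  open Classical in Finset.univ.filter fun y => (y.val : ℝ) + 1 ≤ M * r

theorem lowValues_card_eq {M : ℕ} {r : ℝ} (hr0 : 0 ≤ r) (hr1 : r ≤ 1) :
    (lowValues M r).card = ⌊(M : ℝ) * r⌋₊ := by
  have h1 : ⌊(M : ℝ) * r⌋₊ ≤ M := by
    refine Nat.floor_le_of_le ?_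
    exact mul_le_of_le_one_right (by positivity) hr1
  have h2 : lowValues M r = Finset.univ.filter fun y : Fin M => y.val < ⌊(M : ℝ) * r⌋₊ := by
    ext y
    simp only [lowValues, Finset.mem_filter, Finset.mem_univ, true_and]
    rw [← Nat.succ_le_iff, Nat.le_floor_iff (by positivity)]
    push_cast
    rfl
  rw [h2, Fin.card_filter_val_lt, min_eq_right h1]

theorem lowValues_card_div_le {M : ℕ} {r : ℝ} (hM : 0 < M) (hr0 : 0 ≤ r) (hr1 : r ≤ 1) :
    ((lowValues M r).card : ℝ) / M ≤ r := by
  rw [lowValues_card_eq hr0 hr1, div_le_iff₀ (by positivity), mul_comm r]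
  exact Nat.floor_le (by positivity)

theorem sub_le_lowValues_card_div {M : ℕ} {r : ℝ} (hM : 0 < M) (hr0 : 0 ≤ r) (hr1 : r ≤ 1) :
    r - 1 / M ≤ ((lowValues M r).card : ℝ) / M := by
  have hM' : (0 : ℝ) < M := by positivity
  rw [lowValues_card_eq hr0 hr1, le_div_iff₀ hM', sub_mul, one_div, inv_mul_cancel₀ hM'.ne']
  linarith [Nat.lt_floor_add_one ((M : ℝ) * r)]

/-! ### Numerical estimates -/

theorem rpow_estimates :
    (0.835 : ℝ) ≤ (6 : ℝ) ^ (-0.1 : ℝ) ∧ (1.1 : ℝ) ^ (0.9 : ℝ) ≤ 1.09 ∧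
      (1 / 2 : ℝ) ^ (-0.1 : ℝ) ≤ 2 := by
  refine ⟨?_, ?_, ?_⟩
  · refine le_of_pow_le_pow_left₀ (n := 10) (by norm_num) (by positivity) ?_
    rw [← Real.rpow_mul_natCast (by norm_num)]
    norm_num [Real.rpow_neg_one]
  · refine le_of_pow_le_pow_left₀ (n := 10) (by norm_num) (by positivity) ?_
    rw [← Real.rpow_mul_natCast (by norm_num)]
    have : (0.9 : ℝ) * ((10 : ℕ) : ℝ) = ((9 : ℕ) : ℝ) := by norm_num
    rw [this, Real.rpow_natCast]
    norm_num
  · refine le_of_pow_le_pow_left₀ (n := 10) (by norm_num) (by positivity) ?_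
    rw [← Real.rpow_mul_natCast (by norm_num)]
    norm_num [Real.rpow_neg_one]

/-- The Chebyshev bound `V / (m - t) ^ 2` for the mean `m`, the variance `V` and the threshold `t`
of the number of sampled neighbors. The mean exceeds the threshold by a constant multiple of
`d ^ 0.9`, because `6 ^ (-0.1) / 3 > 1.1 ^ 0.9 / 4`. The `1` subtracted in `hm` is the loss from the
granularity `1 / M` of the sampling probabilities, summed over at most `d ≤ M` neighbors. -/
theorem chebyshev_numerics {d p m V : ℝ} (hd : 10 ^ 10 ≤ d) (hp0 : 0 ≤ p) (hp : p ≤ 1.1 * d)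
    (hm : d / 3 * (6 * d) ^ (-0.1 : ℝ) - 1 ≤ m)
    (hV : V ≤ d * ((1 / 2) * d) ^ (-0.1 : ℝ)) :
    0 < m - (1 / 4) * p ^ (0.9 : ℝ) ∧
      V ≤ d ^ (-0.1 : ℝ) * (m - (1 / 4) * p ^ (0.9 : ℝ)) ^ 2 := by
  obtain ⟨e1, e2, e3⟩ := rpow_estimates
  have hd0 : 0 < d := lt_of_lt_of_le (by norm_num) hd
  set D := d ^ (0.9 : ℝ) with hD
  set r := d ^ (-0.1 : ℝ) with hr
  have hr0 : 0 < r := by positivity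
  have hdr : d * r = D := by
    rw [hD, hr, ← Real.rpow_one_add' hd0.le (by norm_num)]
    norm_num
  -- `r * D = d ^ 0.8` is large
  have hrD : 10 ^ 8 ≤ r * D := by
    have h1 : ((10 : ℝ) ^ 10) ^ (0.8 : ℝ) ≤ d ^ (0.8 : ℝ) :=
      Real.rpow_le_rpow (by positivity) hd (by norm_num)
    have h2 : ((10 : ℝ) ^ 10) ^ (0.8 : ℝ) = 10 ^ 8 := by
      rw [← Real.rpow_natCast, ← Real.rpow_natCast, ← Real.rpow_mul (by norm_num)]
      norm_num
    rw [hD, hr, ← Real.rpow_add hd0]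
    norm_num at h1 h2 ⊢
    linarith
  have hr1 : r ≤ 1 := Real.rpow_le_one_of_one_le_of_nonpos (by linarith) (by norm_num)
  have hD0 : 0 < D := by positivity
  have hD8 : 10 ^ 8 ≤ D := hrD.trans (mul_le_of_le_one_left hD0.le hr1)
  have hm' : 0.278 * D - 1 ≤ m := by
    rw [Real.mul_rpow (by norm_num) hd0.le] at hm
    have h1 : 0.835 * D ≤ 6 ^ (-0.1 : ℝ) * D := mul_le_mul_of_nonneg_right e1 hD0.le
    have h2 : d / 3 * (6 ^ (-0.1 : ℝ) * r) = 6 ^ (-0.1 : ℝ) * D / 3 := by rw [← hdr]; ring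
    rw [h2] at hm
    linarith
  have hp' : p ^ (0.9 : ℝ) ≤ 1.09 * D := by
    refine (Real.rpow_le_rpow hp0 hp (by norm_num)).trans ?_
    rw [Real.mul_rpow (by norm_num) hd0.le]
    exact mul_le_mul_of_nonneg_right e2 hD0.le
  have hV' : V ≤ 2 * D := by
    rw [Real.mul_rpow (by norm_num) hd0.le] at hV
    have h1 : (1 / 2) ^ (-0.1 : ℝ) * D ≤ 2 * D := mul_le_mul_of_nonneg_right e3 hD0.le
    have h2 : d * ((1 / 2) ^ (-0.1 : ℝ) * r) = (1 / 2) ^ (-0.1 : ℝ) * D := by rw [← hdr]; ring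
    rw [h2] at hV
    linarith
  have hgap : 0.005 * D ≤ m - (1 / 4) * p ^ (0.9 : ℝ) := by linarith
  refine ⟨lt_of_lt_of_le (by positivity) hgap, hV'.trans ?_⟩
  calc 2 * D ≤ (0.005 ^ 2 * (r * D)) * D := mul_le_mul_of_nonneg_right (by linarith) hD0.le
    _ = r * (0.005 * D) ^ 2 := by ring
    _ ≤ _ := by gcongr

/-! ### The expected cost of a node -/

namespace PaletteGraph

variable {n : ℕ} {Color : Type*} (G : PaletteGraph n Color)

theorem deg_lt (v : Fin n) : G.deg v < n := by
  classical
  have h1 : G.nbr v ⊆ Finset.univ.erase v := by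
    intro u hu
    simp only [nbr, Finset.mem_filter, Finset.mem_univ, true_and] at hu
    simpa using hu.ne'
  have h2 := Finset.card_le_card h1
  rw [Finset.card_erase_of_mem (Finset.mem_univ v), Finset.card_univ, Fintype.card_fin] at h2
  have := v.pos
  unfold deg
  omega

theorem deg_lt_pal {v : Fin n} (hv : v ∈ G.verts) : G.deg v < G.pal v := by
  have h := G.degree_lt v hv
  have h1 : (G.graph.neighborSet v).ncard = G.deg v := by
    rw [deg, ← Set.ncard_coe_finset]
    congr 1
    ext u
    simp [nbr]
  unfold pal
  omega

theorem sampleProb_nonneg (v : Fin n) : 0 ≤ G.sampleProb v := by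
  unfold sampleProb
  split_ifs <;> positivity

theorem sampleProb_le_one (v : Fin n) : G.sampleProb v ≤ 1 := by
  unfold sampleProb
  split_ifs with h
  · exact le_rfl
  · refine Real.rpow_le_one_of_one_le_of_nonpos ?_ (by norm_num)
    exact_mod_cast Nat.one_le_iff_ne_zero.2 h

theorem mem_verts_of_mem_nbr {u v : Fin n} (h : u ∈ G.nbr v) : u ∈ G.verts := by
  simp only [nbr, Finset.mem_filter, Finset.mem_univ, true_and] at h
  exact G.mem_of_adj u v h.symm

theorem mem_sampled {N M : ℕ} (hN : n ≤ N) (h : Fin N → Fin M) (v : Fin n) :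
    v ∈ G.sampled hN h ↔ v ∈ G.verts ∧ h (Fin.castLE hN v) ∈ lowValues M (G.sampleProb v) := by
  simp [sampled, lowValues]

theorem mem_failed (S : Finset (Fin n)) (v : Fin n) :
    v ∈ G.failed S ↔ v ∈ G.verts ∧ ¬ G.Successful S v := by
  simp [failed]

section Expectation

variable {k s N M : ℕ} {H : Fin s → Fin N → Fin M}

theorem card_mem_sampled_le (hH : IsKWiseIndependent k H) (hs : 0 < s) (hM : 0 < M) (hN : n ≤ N)
    (v : Fin n) :
    ((Finset.univ.filter fun σ => v ∈ G.sampled hN (H σ)).card : ℝ) ≤ s * G.sampleProb v := by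
  have h1 : (Finset.univ.filter fun σ => v ∈ G.sampled hN (H σ)).card ≤
      (Finset.univ.filter fun σ =>
        H σ (Fin.castLE hN v) ∈ lowValues M (G.sampleProb v)).card :=
    Finset.card_le_card fun σ => by
      simp only [Finset.mem_filter, mem_sampled]
      tauto
  calc _ ≤ _ := Nat.cast_le.2 h1
    _ = _ := hH.card_mem hs _ _
    _ ≤ _ := mul_le_mul_of_nonneg_left
      (lowValues_card_div_le hM (G.sampleProb_nonneg v) (G.sampleProb_le_one v)) (by positivity)

/-- A node whose palette is large fails with probability at most `d(v) ^ (-0.1)`: this is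
Chebyshev's inequality for the number of sampled neighbors of similar degree. -/
theorem card_mem_failed_le (hH : IsKWiseIndependent k H) (hk : 2 ≤ k) (hs : 0 < s) (hN : n ≤ N)
    (hM : n ≤ M) {v : Fin n} (hp : 2 * 10 ^ 10 ≤ (G.pal v : ℝ)) :
    ((Finset.univ.filter fun σ => v ∈ G.failed (G.sampled hN (H σ))).card : ℝ) ≤
      s * (G.deg v : ℝ) ^ (-0.1 : ℝ) := by
  classical
  by_cases hsucc : (1.1 : ℝ) * (G.deg v : ℝ) ≤ (G.pal v : ℝ) ∨
      ((G.similarNbr v).card : ℝ) ≤ (1 / 3 : ℝ) * (G.deg v : ℝ)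
  · rw [Finset.filter_false_of_mem]
    · simp only [Finset.card_empty, Nat.cast_zero]
      positivity
    · intro σ _ h
      rw [mem_failed, Successful] at h
      tauto
  push Not at hsucc
  obtain ⟨hpd, hsim⟩ := hsucc
  have hM0 : 0 < M := v.pos.trans_le hM
  have hd : 10 ^ 10 ≤ (G.deg v : ℝ) := by linarith
  have hd0 : (0 : ℝ) < G.deg v := lt_of_lt_of_le (by norm_num) hd
  let U := G.similarNbr v
  have hU : ∀ u ∈ U, u ∈ G.nbr v ∧
      (1 / 2 : ℝ) * (G.deg v : ℝ) ≤ (G.deg u : ℝ) ∧ (G.deg u : ℝ) ≤ 6 * (G.deg v : ℝ) := by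
    intro u hu
    simpa [U, similarNbr] using hu
  have hr : ∀ u ∈ U, G.sampleProb u = (G.deg u : ℝ) ^ (-0.1 : ℝ) := by
    intro u hu
    have h1 : (0 : ℝ) < G.deg u := lt_of_lt_of_le (by positivity) (hU u hu).2.1
    rw [sampleProb, if_neg (by exact_mod_cast h1.ne')]
  let q : Fin n → ℝ := fun u => ((lowValues M (G.sampleProb u)).card : ℝ) / M
  let E : Fin n → Fin s → Prop := fun u σ =>
    H σ (Fin.castLE hN u) ∈ lowValues M (G.sampleProb u)
  have hcheb := sum_sq_sub_mean_le U E q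
    (fun u _ => by rw [Fintype.card_fin]; exact hH.card_mem hs _ _)
    (fun u _ w _ huw => by
      rw [Fintype.card_fin]
      exact hH.card_mem_and_mem hk hs (fun h => huw (Fin.castLE_injective hN h)) _ _)
  rw [Fintype.card_fin] at hcheb
  have hUd : (U.card : ℝ) ≤ G.deg v :=
    Nat.cast_le.2 (Finset.card_le_card (Finset.filter_subset _ _))
  have hm : (G.deg v : ℝ) / 3 * (6 * (G.deg v : ℝ)) ^ (-0.1 : ℝ) - 1 ≤ ∑ u ∈ U, q u := by
    have h1 : ∀ u ∈ U, (6 * (G.deg v : ℝ)) ^ (-0.1 : ℝ) - 1 / M ≤ q u := by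
      intro u hu
      refine le_trans ?_ (sub_le_lowValues_card_div hM0 (G.sampleProb_nonneg u)
        (G.sampleProb_le_one u))
      rw [hr u hu]
      have h2 : (0 : ℝ) < G.deg u := lt_of_lt_of_le (by positivity) (hU u hu).2.1
      have := Real.rpow_le_rpow_of_nonpos h2 (hU u hu).2.2 (z := (-0.1 : ℝ)) (by norm_num)
      linarith
    have h2 : (U.card : ℝ) * (1 / M) ≤ 1 := by
      rw [mul_one_div, div_le_one (by positivity)]
      exact hUd.trans (by exact_mod_cast (G.deg_lt v).le.trans hM)
    have h3 : (G.deg v : ℝ) / 3 * (6 * (G.deg v : ℝ)) ^ (-0.1 : ℝ) ≤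
        U.card * (6 * (G.deg v : ℝ)) ^ (-0.1 : ℝ) :=
      mul_le_mul_of_nonneg_right (by linarith) (by positivity)
    have h4 := Finset.card_nsmul_le_sum U q _ h1
    rw [nsmul_eq_mul, mul_sub] at h4
    linarith
  have hV : ∑ u ∈ U, q u ≤ (G.deg v : ℝ) * ((1 / 2) * (G.deg v : ℝ)) ^ (-0.1 : ℝ) := by
    have h1 : ∀ u ∈ U, q u ≤ ((1 / 2) * (G.deg v : ℝ)) ^ (-0.1 : ℝ) := by
      intro u hu
      refine (lowValues_card_div_le hM0 (G.sampleProb_nonneg u) (G.sampleProb_le_one u)).trans ?_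
      rw [hr u hu]
      exact Real.rpow_le_rpow_of_nonpos (by positivity) (hU u hu).2.1 (by norm_num)
    refine (Finset.sum_le_card_nsmul U q _ h1).trans ?_
    rw [nsmul_eq_mul]
    exact mul_le_mul_of_nonneg_right hUd (by positivity)
  obtain ⟨hgap, hfin⟩ := chebyshev_numerics hd (by positivity) hpd.le hm hV
  set m := ∑ u ∈ U, q u
  set gap := m - (1 / 4) * (G.pal v : ℝ) ^ (0.9 : ℝ) with hgapdef
  set F := Finset.univ.filter fun σ => v ∈ G.failed (G.sampled hN (H σ)) with hF
  -- on failure, the number of sampled similar neighbors is off its mean by at least `gap`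
  have hdev : ∀ σ ∈ F, gap ^ 2 ≤ (((U.filter fun u => E u σ).card : ℝ) - m) ^ 2 := by
    intro σ hσ
    simp only [hF, failed, Successful, Finset.mem_filter, Finset.mem_univ, true_and, not_or,
      not_le] at hσ
    have h1 : (U.filter fun u => E u σ).card ≤ (G.nbr v ∩ G.sampled hN (H σ)).card := by
      refine Finset.card_le_card fun u hu => ?_
      rw [Finset.mem_filter] at hu
      have h2 := (hU u hu.1).1
      rw [Finset.mem_inter, mem_sampled]
      exact ⟨h2, G.mem_verts_of_mem_nbr h2, hu.2⟩
    have h2 : ((U.filter fun u => E u σ).card : ℝ) ≤ (G.nbr v ∩ G.sampled hN (H σ)).card :=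
      Nat.cast_le.2 h1
    rw [← neg_sq (_ - m)]
    exact pow_le_pow_left₀ hgap.le (by linarith [hσ.2.2.2]) 2
  have hsum : F.card * gap ^ 2 ≤ s * m := by
    refine le_trans ?_ hcheb
    rw [← nsmul_eq_mul]
    exact (Finset.card_nsmul_le_sum F _ _ hdev).trans
      (Finset.sum_le_univ_sum_of_nonneg fun _ => sq_nonneg _)
  have h3 : s * m ≤ s * ((G.deg v : ℝ) ^ (-0.1 : ℝ) * gap ^ 2) :=
    mul_le_mul_of_nonneg_left hfin (by positivity)
  rw [← mul_assoc] at h3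
  exact le_of_mul_le_mul_right (hsum.trans h3) (by positivity)

/-- The cost of node `v` when the choices are made by `h`: its contribution to the sum over the
deferred graph, rounded up to an integer so that it fits into a message. -/
noncomputable def cost (C x : ℝ) (hN : n ≤ N) (h : Fin N → Fin M) (v : Fin n) : ℕ :=
  open Classical in if v ∈ G.deferred C hN h then ⌈(G.deg v : ℝ) ^ (x + 0.1)⌉₊ else 0

theorem ceil_deg_rpow_le {x : ℝ} (hx0 : 0 ≤ x) (hx : x ≤ 0.9) (v : Fin n) :
    ⌈(G.deg v : ℝ) ^ (x + 0.1)⌉₊ ≤ G.deg v := by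
  rw [Nat.ceil_le]
  rcases Nat.eq_zero_or_pos (G.deg v) with h | h
  · rw [h, Nat.cast_zero, Real.zero_rpow (by linarith)]
  · calc (G.deg v : ℝ) ^ (x + 0.1) ≤ (G.deg v : ℝ) ^ (1 : ℝ) :=
          Real.rpow_le_rpow_of_exponent_le (by exact_mod_cast h) (by linarith)
      _ = _ := Real.rpow_one _

theorem cost_le_deg {C x : ℝ} (hx0 : 0 ≤ x) (hx : x ≤ 0.9) (hN : n ≤ N) (h : Fin N → Fin M)
    (v : Fin n) : G.cost C x hN h v ≤ G.deg v := by
  unfold cost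
  split_ifs
  · exact G.ceil_deg_rpow_le hx0 hx v
  · exact Nat.zero_le _

/-- The average cost of a node `v` is at most `C + 2 * d(v) ^ x`. A node of small palette has small
degree. For any other node, being sampled and being failed both have probability at most
`d(v) ^ (-0.1)`, and the rounding costs at most `1`. -/
theorem sum_cost_le (hH : IsKWiseIndependent k H) (hk : 2 ≤ k) (hs : 0 < s) (hN : n ≤ N)
    (hM : n ≤ M) {C x : ℝ} (hC : 2 * 10 ^ 10 ≤ C) (hx0 : 0 ≤ x) (hx : x ≤ 0.9) {v : Fin n}
    (hv : v ∈ G.verts) :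
    ∑ σ, (G.cost C x hN (H σ) v : ℝ) ≤ s * (C + 2 * (G.deg v : ℝ) ^ x) := by
  classical
  have hpow : (0 : ℝ) ≤ (G.deg v : ℝ) ^ x := by positivity
  have hconst : ∀ K : ℝ, (∀ σ, (G.cost C x hN (H σ) v : ℝ) ≤ K) →
      ∑ σ, (G.cost C x hN (H σ) v : ℝ) ≤ s * K := fun K h => by
    simpa using Finset.sum_le_card_nsmul Finset.univ _ K fun σ _ => h σ
  by_cases hsmall : (G.deg v : ℝ) ≤ C
  · refine hconst _ fun σ => ?_
    have h1 : (G.cost C x hN (H σ) v : ℝ) ≤ G.deg v := by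
      exact_mod_cast G.cost_le_deg hx0 hx hN (H σ) v
    linarith
  push Not at hsmall
  have hd0 : (0 : ℝ) < G.deg v := by linarith
  have hp : C < G.pal v := hsmall.trans (by exact_mod_cast G.deg_lt_pal hv)
  have hprob : G.sampleProb v = (G.deg v : ℝ) ^ (-0.1 : ℝ) := by
    rw [sampleProb, if_neg (by exact_mod_cast hd0.ne')]
  have hS := G.card_mem_sampled_le hH hs (v.pos.trans_le hM) hN v
  have hF := G.card_mem_failed_le hH hk hs hN hM (v := v) (by linarith)
  rw [hprob] at hS
  set y := (G.deg v : ℝ) ^ (x + 0.1) with hy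
  have hy0 : 0 ≤ y := by positivity
  have hle : ∀ σ, (G.cost C x hN (H σ) v : ℝ) ≤ (if v ∈ G.sampled hN (H σ) then 1 else 0) * y +
      (if v ∈ G.failed (G.sampled hN (H σ)) then 1 else 0) * y + 1 := by
    intro σ
    have h1 : (⌈y⌉₊ : ℝ) ≤ y + 1 := (Nat.ceil_lt_add_one hy0).le
    have h2 : v ∉ G.small C := by simp [small, hp.le]
    unfold cost
    rw [← hy]
    simp only [deferred, Finset.mem_union, h2, or_false]
    split_ifs with h3 h4 h5 h5 h5 h5 <;> first | (push_cast; linarith) | tauto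
  have hyr : y * (G.deg v : ℝ) ^ (-0.1 : ℝ) = (G.deg v : ℝ) ^ x := by
    rw [hy, ← Real.rpow_add hd0]
    congr 1
    ring
  have hsS := mul_le_mul_of_nonneg_left hS hy0
  have hsF := mul_le_mul_of_nonneg_left hF hy0
  calc _ ≤ _ := Finset.sum_le_sum fun σ _ => hle σ
    _ = y * (Finset.univ.filter fun σ => v ∈ G.sampled hN (H σ)).card +
        y * (Finset.univ.filter fun σ => v ∈ G.failed (G.sampled hN (H σ))).card + s := by
      simp only [Finset.sum_add_distrib, ← Finset.sum_mul, Finset.sum_boole, Finset.sum_const,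
        Finset.card_univ, Fintype.card_fin, nsmul_eq_mul]
      ring
    _ ≤ s * (y * (G.deg v : ℝ) ^ (-0.1 : ℝ)) + s * (y * (G.deg v : ℝ) ^ (-0.1 : ℝ)) + s * C := by
      have : (s : ℝ) * 1 ≤ s * C := mul_le_mul_of_nonneg_left (by linarith) (by positivity)
      linarith
    _ = _ := by rw [hyr]; ring

end Expectation

end PaletteGraph

/-! ### Composing rounds of the congested clique -/

/-- `Computes b R inp f`: some algorithm with messages of `b` bits has, on every instance `i`, the
output `f i v` at every node `v` after `R` rounds, when the inputs of the nodes are `inp i`. -/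
def Computes {n : ℕ} (b R : ℕ) {ι Input Output : Type*} (inp : ι → Fin n → Input)
    (f : ι → Fin n → Output) : Prop :=
  ∃ A : CliqueAlgorithm n b Input Output, ∀ i, A.run R (inp i) = f i

namespace Computes

variable {n b R : ℕ} {ι Input : Type*} {inp : ι → Fin n → Input}

theorem local_input {α : Type} (φ : Fin n → Input → α) :
    Computes b 0 inp fun i v => φ v (inp i v) :=
  ⟨⟨α, φ, fun _ _ _ => false, fun a _ => a, id⟩, fun _ => rfl⟩

/-- Nodes may forget: whatever is determined by a computed value is computed as well. -/
theorem of_determined {α β : Type*} [Nonempty β] {f : ι → Fin n → α} (hf : Computes b R inp f)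
    (g : ι → Fin n → β) (h : ∀ i j u v, f i u = f j v → g i u = g j v) :
    Computes b R inp g := by
  obtain ⟨A, hA⟩ := hf
  obtain ⟨e, he⟩ := (Function.factorsThrough_iff (f := fun q : ι × Fin n => f q.1 q.2)
    (fun q : ι × Fin n => g q.1 q.2)).1 fun q r hqr => h _ _ _ _ hqr
  refine ⟨⟨A.State, A.init, A.send, A.receive, e ∘ A.output⟩, fun i => funext fun v => ?_⟩
  have h1 : e (f i v) = g i v := (congrFun he (i, v)).symm
  have h2 := congrFun (hA i) v
  rw [← h1, ← h2]
  rfl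

/-- The algorithm that runs `A` for `R` rounds, then sends one more message, which depends on the
output of `A` only, and outputs this output together with the messages received. Its states carry
a counter of the rounds left to `A`. -/
def extend {α : Type} (A : CliqueAlgorithm n b Input α) (R : ℕ)
    (send : α → Fin n → (Fin b → Bool)) :
    CliqueAlgorithm n b Input (α × (Fin n → (Fin b → Bool))) where
  State := ℕ × A.State × (Fin n → (Fin b → Bool))
  init v a := (R, A.init v a, fun _ _ => false)
  send q v := if q.1 = 0 then send (A.output q.2.1) v else A.send q.2.1 v
  receive q m := if q.1 = 0 then (0, q.2.1, m) else (q.1 - 1, A.receive q.2.1 m, m)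
  output q := (A.output q.2.1, q.2.2)

theorem run_extend {α : Type} (A : CliqueAlgorithm n b Input α) (R : ℕ)
    (send : α → Fin n → (Fin b → Bool)) (a : Fin n → Input) :
    (extend A R send).run (R + 1) a =
      fun v => (A.run R a v, fun u => send (A.run R a u) v) := by
  have key : ∀ t ≤ R, ∃ m : Fin n → Fin n → (Fin b → Bool),
      (extend A R send).step^[t] (fun u => (extend A R send).init u (a u)) =
        fun v => (R - t, A.step^[t] (fun u => A.init u (a u)) v, m v) := by
    intro t
    induction t with
    | zero => exact fun _ => ⟨fun _ _ _ => false, rfl⟩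
    | succ t ih =>
      intro ht
      obtain ⟨m, hm⟩ := ih (by omega)
      have h0 : R - t ≠ 0 := by omega
      refine ⟨fun v u => A.send (A.step^[t] (fun u => A.init u (a u)) u) v, ?_⟩
      rw [Function.iterate_succ_apply', hm, Function.iterate_succ_apply']
      funext v
      simp only [CliqueAlgorithm.step, extend, h0, if_false]
      rfl
  obtain ⟨m, hm⟩ := key R le_rfl
  funext v
  simp only [CliqueAlgorithm.run]
  rw [Function.iterate_succ_apply', hm]
  simp [CliqueAlgorithm.step, extend]

/-- One more round, in which every node `u` sends to every node `v` a number `m i u v` that is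
determined by what `u` has computed. -/
theorem exchange {α : Type} {f : ι → Fin n → α} (hf : Computes b R inp f)
    (m : ι → Fin n → Fin n → ℕ) (hm : ∀ i u v, m i u v < 2 ^ b)
    (h : ∀ i j u v, f i u = f j v → m i u = m j v) :
    Computes b (R + 1) inp fun i v => (f i v, fun u => m i u v) := by
  obtain ⟨A, hA⟩ := hf
  obtain ⟨e, he⟩ := (Function.factorsThrough_iff (f := fun q : ι × Fin n => f q.1 q.2)
    (fun q : ι × Fin n => m q.1 q.2)).1 fun q r hqr => h _ _ _ _ hqr
  let E : (Fin b → Bool) ≃ Fin (2 ^ b) := Fintype.equivFinOfCardEq (by simp)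
  let send : α → Fin n → (Fin b → Bool) := fun a v =>
    E.symm (Fin.ofNat (2 ^ b) (e a v))
  let A' := extend A R send
  refine ⟨⟨A'.State, A'.init, A'.send, A'.receive,
    fun q => ((A'.output q).1, fun u => (E ((A'.output q).2 u) : ℕ))⟩, fun i => ?_⟩
  have h1 := run_extend A R send (inp i)
  rw [hA i] at h1
  funext v
  have h2 := congrFun h1 v
  change ((A'.run (R + 1) (inp i) v).1, fun u => (E ((A'.run (R + 1) (inp i) v).2 u) : ℕ)) = _
  rw [h2]
  refine Prod.ext rfl (funext fun u => ?_)
  have h3 : e (f i u) = m i u := (congrFun he (i, u)).symm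
  simp [send, h3, Nat.mod_eq_of_lt (hm i u v)]

end Computes

/-! ### The method of conditional expectations -/

/-- If a nonempty set is cut into blocks, then on some nonempty block the average of `w` is at
most the average over the whole set. -/
theorem exists_block_average_le {α β : Type*} [Fintype β] [DecidableEq β] (P : Finset α)
    (hP : P.Nonempty) (w : α → ℕ) (δ : α → β) :
    ∃ d, (P.filter fun a => δ a = d).Nonempty ∧
      (∑ a ∈ P with δ a = d, w a) * P.card ≤
        (∑ d', ∑ a ∈ P with δ a = d', w a) * (P.filter fun a => δ a = d).card := by
  by_contra! hcon
  have h1 : ∀ d, (∑ d', ∑ a ∈ P with δ a = d', w a) * (P.filter fun a => δ a = d).card ≤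
      (∑ a ∈ P with δ a = d, w a) * P.card := by
    intro d
    rcases (P.filter fun a => δ a = d).eq_empty_or_nonempty with h | h
    · simp [h]
    · exact (hcon d h).le
  have hcard : ∑ d, (P.filter fun a => δ a = d).card = P.card :=
    (Finset.card_eq_sum_card_fiberwise fun _ _ => by simp).symm
  obtain ⟨a, ha⟩ := hP
  have h2 := Finset.sum_lt_sum (fun d _ => h1 d)
    ⟨δ a, Finset.mem_univ _, hcon (δ a) ⟨a, by simp [ha]⟩⟩
  rw [← Finset.mul_sum, ← Finset.sum_mul, hcard] at h2
  exact lt_irrefl _ h2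

/-- A block as in `exists_block_average_le`, chosen as a function of the set and of the block sums
only, so that all nodes who know these choose the same block. -/
theorem exists_block_selection {α β : Type*} [Fintype β] [DecidableEq β] [Nonempty β]
    (δ : α → β) :
    ∃ sel : Finset α → (β → ℕ) → β, ∀ (P : Finset α) (w : α → ℕ), P.Nonempty →
      (P.filter fun a => δ a = sel P fun d' => ∑ a ∈ P with δ a = d', w a).Nonempty ∧
      (∑ a ∈ P with δ a = sel P fun d' => ∑ a ∈ P with δ a = d', w a, w a) * P.card ≤
        (∑ a ∈ P, w a) *
          (P.filter fun a => δ a = sel P fun d' => ∑ a ∈ P with δ a = d', w a).card := by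
  classical
  refine ⟨fun P W => Classical.epsilon fun d => (P.filter fun a => δ a = d).Nonempty ∧
    W d * P.card ≤ (∑ d', W d') * (P.filter fun a => δ a = d).card, fun P w hP => ?_⟩
  have h := Classical.epsilon_spec (exists_block_average_le P hP w δ)
  rw [← Finset.sum_fiberwise P δ w]
  exact h

/-- Derandomization. The indices are read as numbers with `c` digits in base `n`, and the digits
are fixed one by one. For each digit, node `d` collects the total cost of those remaining indices
whose next digit is `d`, and broadcasts it. -/
theorem Computes.exists_le_average {n b R c s : ℕ} {ι Input : Type*} {inp : ι → Fin n → Input}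
    (hn : 1 ≤ n) (hb : n ^ (c + 2) ≤ 2 ^ b) (hs0 : 0 < s) (hs : s ≤ n ^ c)
    (g : ι → Fin n → Fin s → ℕ) (hg : ∀ i v σ, g i v σ < n)
    (hcomp : Computes b R inp fun i v => (v, g i v)) :
    ∃ σ : ι → Fin s, (∀ i, (∑ v, g i v (σ i)) * s ≤ ∑ τ, ∑ v, g i v τ) ∧
      Computes b (R + 2 * c) inp fun i _ => σ i := by
  have : Nonempty (Fin n) := ⟨⟨0, hn⟩⟩
  have : Nonempty (Fin s) := ⟨⟨0, hs0⟩⟩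
  -- one node's cost of a set of indices is less than `n ^ (c + 1)`
  have hbound : ∀ i v (Q : Finset (Fin s)), ∑ σ ∈ Q, g i v σ < n ^ (c + 1) := by
    intro i v Q
    have h1 : ∑ σ ∈ Q, g i v σ ≤ s * (n - 1) := by
      refine (Finset.sum_le_card_nsmul Q _ (n - 1) fun σ _ => by have := hg i v σ; omega).trans ?_
      rw [smul_eq_mul]
      exact Nat.mul_le_mul_right _ (by simpa using Finset.card_le_univ Q)
    calc _ ≤ n ^ c * (n - 1) := h1.trans (Nat.mul_le_mul_right _ hs)
      _ < n ^ c * n := Nat.mul_lt_mul_of_pos_left (by omega) (by positivity)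
      _ = _ := (pow_succ _ _).symm
  have hmono : n ^ (c + 1) ≤ 2 ^ b := (Nat.pow_le_pow_right hn (by omega)).trans hb
  have hind : ∀ j : ℕ, ∃ P : ι → Finset (Fin s),
      (∀ i, (P i).Nonempty ∧
        (∑ σ ∈ P i, ∑ v, g i v σ) * s ≤ (∑ τ, ∑ v, g i v τ) * (P i).card ∧
        ∀ σ ∈ P i, ∀ τ ∈ P i, (σ : ℕ) % n ^ j = (τ : ℕ) % n ^ j) ∧
      Computes b (R + 2 * j) inp fun i v => (v, g i v, P i) := by
    intro j
    induction j with
    | zero =>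
      refine ⟨fun _ => Finset.univ, fun i => ⟨Finset.univ_nonempty, by simp, ?_⟩, ?_⟩
      · simp [Nat.mod_one]
      · exact hcomp.of_determined _ fun i j u v h => by simpa using h
    | succ j ih =>
      obtain ⟨P, hP, hPc⟩ := ih
      let δ : Fin s → Fin n := fun σ => ⟨(σ : ℕ) / n ^ j % n, Nat.mod_lt _ hn⟩
      obtain ⟨sel, hsel⟩ := exists_block_selection δ
      let W : ι → Fin n → ℕ := fun i d => ∑ σ ∈ P i with δ σ = d, ∑ v, g i v σ
      have hW : ∀ i d, W i d = ∑ v, ∑ σ ∈ P i with δ σ = d, g i v σ := fun i d =>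
        Finset.sum_comm
      refine ⟨fun i => (P i).filter fun σ => δ σ = sel (P i) (W i), fun i => ?_, ?_⟩
      · obtain ⟨hne, hle, hmod⟩ := hP i
        obtain ⟨h1, h2⟩ := hsel (P i) (fun σ => ∑ v, g i v σ) hne
        refine ⟨h1, ?_, ?_⟩
        · have h3 := Nat.mul_le_mul_right s h2
          have h4 := Nat.mul_le_mul_right
            ((P i).filter fun σ => δ σ = sel (P i) (W i)).card hle
          refine Nat.le_of_mul_le_mul_right (c := (P i).card) ?_ hne.card_pos
          calc _ = (∑ σ ∈ P i with δ σ = sel (P i) (W i), ∑ v, g i v σ) * (P i).card * s := by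
                ring
            _ ≤ _ := h3
            _ = _ := mul_right_comm _ _ _
            _ ≤ _ := h4
            _ = _ := mul_right_comm _ _ _
        · intro σ hσ τ hτ
          rw [Finset.mem_filter] at hσ hτ
          have h3 : (σ : ℕ) / n ^ j % n = (τ : ℕ) / n ^ j % n :=
            congrArg Fin.val (hσ.2.trans hτ.2.symm)
          rw [Nat.mod_pow_succ, Nat.mod_pow_succ, hmod σ hσ.1 τ hτ.1, h3]
      · have c1 := hPc.exchange (fun i u d => ∑ σ ∈ P i with δ σ = d, g i u σ)
          (fun i u d => (hbound i u _).trans_le hmono) fun i i' u v h => by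
            simp only [Prod.mk.injEq] at h
            obtain ⟨-, h1, h2⟩ := h
            simp only [h1, h2]
        have c2 := c1.of_determined (fun i v => ((v, g i v, P i), W i v)) fun i i' u v h => by
          obtain ⟨h1, h2⟩ := Prod.mk.inj h
          refine Prod.ext h1 ?_
          simp only [hW]
          exact Finset.sum_congr rfl fun w _ => congrFun h2 w
        have c3 := c2.exchange (fun i u _ => W i u) (fun i u _ => by
            rw [hW]
            refine lt_of_lt_of_le (Finset.sum_lt_sum_of_nonempty Finset.univ_nonempty
              fun v _ => hbound i v _) ?_
            simpa [pow_succ, mul_comm, mul_left_comm] using hb) fun i i' u v h => by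
          simp only [Prod.mk.injEq] at h
          simp only [h.2]
        exact c3.of_determined _ fun i i' u v h => by
          simp only [Prod.mk.injEq] at h
          obtain ⟨⟨⟨rfl, h1, h2⟩, -⟩, h3⟩ := h
          have h4 : W i = W i' := h3
          simp only [h1, h2, h4]
  obtain ⟨P, hP, hPc⟩ := hind c
  refine ⟨fun i => (hP i).1.choose, fun i => ?_, hPc.of_determined _ fun i i' u v h => ?_⟩
  · obtain ⟨hne, hle, hmod⟩ := hP i
    have h1 : P i = {hne.choose} := by
      refine Finset.eq_singleton_iff_unique_mem.2 ⟨hne.choose_spec, fun τ hτ => ?_⟩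
      have h2 := hmod τ hτ _ hne.choose_spec
      rw [Nat.mod_eq_of_lt (τ.2.trans_le hs), Nat.mod_eq_of_lt (Fin.is_lt _ |>.trans_le hs)] at h2
      exact Fin.ext h2
    rw [h1] at hle
    simpa using hle
  · simp only [Prod.mk.injEq] at h
    simp only [h.2.2]

/-! ### The algorithm -/

namespace PaletteGraph

variable {n : ℕ} {Color : Type*}

/-- Whether `v` is deferred depends only on the initial knowledge of `v` and on all degrees. -/
theorem cost_congr {N M : ℕ} {C x : ℝ} (hN : n ≤ N) (h : Fin N → Fin M)
    {G G' : PaletteGraph n Color} {v : Fin n} (hact : v ∈ G.verts ↔ v ∈ G'.verts)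
    (hnbr : G.nbr v = G'.nbr v) (hpal : G.pal v = G'.pal v) (hdeg : G.deg = G'.deg) :
    G.cost C x hN h v = G'.cost C x hN h v := by
  classical
  have hprob : ∀ u, G.sampleProb u = G'.sampleProb u := fun u => by
    rw [sampleProb, sampleProb, hdeg]
  have hsim : G.similarNbr v = G'.similarNbr v := by
    ext u
    simp [similarNbr, hnbr, hdeg]
  have hint : G.nbr v ∩ G.sampled hN h = G'.nbr v ∩ G'.sampled hN h := by
    ext u
    rw [Finset.mem_inter, Finset.mem_inter, mem_sampled, mem_sampled, hprob]
    have h1 := G.mem_verts_of_mem_nbr (u := u) (v := v)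
    have h2 := G'.mem_verts_of_mem_nbr (u := u) (v := v)
    rw [hnbr] at h1 ⊢
    tauto
  have hS : v ∈ G.sampled hN h ↔ v ∈ G'.sampled hN h := by
    rw [mem_sampled, mem_sampled, hprob, hact]
  have hF : v ∈ G.failed (G.sampled hN h) ↔ v ∈ G'.failed (G'.sampled hN h) := by
    rw [mem_failed, mem_failed, Successful, Successful, hact, hpal, hdeg, hsim, hint]
  have hL : v ∈ G.small C ↔ v ∈ G'.small C := by
    simp [small, hact, hpal]
  have hdef : v ∈ G.deferred C hN h ↔ v ∈ G'.deferred C hN h := by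
    simp only [deferred, Finset.mem_union, hS, hF, hL]
  simp only [cost, hdef, hdeg]

/-- After one round, in which all nodes broadcast their degrees, every node knows its own cost for
every hash function. -/
theorem computes_cost {b s N M : ℕ} (H : Fin s → Fin N → Fin M) (C x : ℝ) (hn : 1 ≤ n)
    (hN : n ≤ N) (hb : n ≤ 2 ^ b) :
    Computes b 1 (fun (G : PaletteGraph n Color) v => G.nodeInput v)
      fun G v => (v, fun σ => G.cost C x hN (H σ) v) := by
  have : Nonempty (Fin n) := ⟨⟨0, hn⟩⟩
  have c0 : Computes b 0 (fun (G : PaletteGraph n Color) v => G.nodeInput v)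
      fun G v => (v, (v ∈ G.verts : Prop), G.nbr v, G.pal v) :=
    Computes.local_input fun v (a : NodeInput n Color) => (v, a.active, a.neighbors, a.palette.card)
  have c1 := c0.exchange (fun G u _ => G.deg u) (fun G u _ => (G.deg_lt u).trans_le hb)
    fun G G' u v h => by
      simp only [Prod.mk.injEq] at h
      simp only [deg, h.2.2.1]
  refine c1.of_determined _ fun G G' u v h => ?_
  simp only [Prod.mk.injEq] at h
  obtain ⟨⟨rfl, hact, hnbr, hpal⟩, hdeg⟩ := h
  exact Prod.ext rfl (funext fun σ => cost_congr hN (H σ) (iff_of_eq hact) hnbr hpal hdeg)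

/-- A hash function whose total cost is at most average is good. -/
theorem sum_deferred_le {k s N M : ℕ} {H : Fin s → Fin N → Fin M} (G : PaletteGraph n Color)
    (hH : IsKWiseIndependent k H) (hk : 2 ≤ k) (hs : 0 < s) (hN : n ≤ N) (hM : n ≤ M) {C x : ℝ}
    (hC : 2 * 10 ^ 10 ≤ C) (hx0 : 0 ≤ x) (hx : x ≤ 0.9) {σ : Fin s}
    (hσ : (∑ v, G.cost C x hN (H σ) v) * s ≤ ∑ τ, ∑ v, G.cost C x hN (H τ) v) :
    ∑ v ∈ G.deferred C hN (H σ), (G.deg v : ℝ) ^ (x + 0.1) ≤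
      C * n + 2 * ∑ v ∈ G.verts, (G.deg v : ℝ) ^ x := by
  classical
  have hsub : ∀ τ, G.deferred C hN (H τ) ⊆ G.verts := by
    intro τ v hv
    simp only [deferred, Finset.mem_union, mem_sampled, mem_failed, small, Finset.mem_filter] at hv
    tauto
  have hzero : ∀ v ∉ G.verts, ∀ τ, G.cost C x hN (H τ) v = 0 := fun v hv τ =>
    if_neg fun h => hv (hsub τ h)
  have h1 : ∑ v ∈ G.deferred C hN (H σ), (G.deg v : ℝ) ^ (x + 0.1) ≤
      ((∑ v, G.cost C x hN (H σ) v : ℕ) : ℝ) := by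
    push_cast
    calc _ ≤ ∑ v ∈ G.deferred C hN (H σ), (G.cost C x hN (H σ) v : ℝ) :=
          Finset.sum_le_sum fun v hv => by
            rw [cost, if_pos hv]
            exact Nat.le_ceil _
      _ ≤ _ := Finset.sum_le_univ_sum_of_nonneg fun _ => Nat.cast_nonneg _
  have h2 : ((∑ τ, ∑ v, G.cost C x hN (H τ) v : ℕ) : ℝ) ≤
      s * (C * n + 2 * ∑ v ∈ G.verts, (G.deg v : ℝ) ^ x) := by
    rw [Finset.sum_comm]
    push_cast
    calc _ = ∑ v ∈ G.verts, ∑ τ, (G.cost C x hN (H τ) v : ℝ) := by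
          refine (Finset.sum_subset (Finset.subset_univ _) fun v _ hv => ?_).symm
          simp [hzero v hv]
      _ ≤ ∑ v ∈ G.verts, s * (C + 2 * (G.deg v : ℝ) ^ x) :=
          Finset.sum_le_sum fun v hv => G.sum_cost_le hH hk hs hN hM hC hx0 hx hv
      _ = s * (G.verts.card * C + 2 * ∑ v ∈ G.verts, (G.deg v : ℝ) ^ x) := by
          rw [← Finset.mul_sum, Finset.sum_add_distrib, ← Finset.mul_sum, Finset.sum_const,
            nsmul_eq_mul]
      _ ≤ _ := by
          have hcard : (G.verts.card : ℝ) ≤ n := by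
            exact_mod_cast (Finset.card_le_univ G.verts).trans_eq (Fintype.card_fin n)
          have : (G.verts.card : ℝ) * C ≤ C * n := by
            rw [mul_comm]
            exact mul_le_mul_of_nonneg_left hcard (by linarith)
          gcongr
  have h3 : ((∑ v, G.cost C x hN (H σ) v : ℕ) : ℝ) * s ≤
      ((∑ τ, ∑ v, G.cost C x hN (H τ) v : ℕ) : ℝ) := by exact_mod_cast hσ
  have hs' : (0 : ℝ) < s := by exact_mod_cast hs
  refine h1.trans (le_of_mul_le_mul_right ((h3.trans h2).trans_eq (mul_comm _ _)) hs')

end PaletteGraph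

/-- A family of functions with uniformly distributed values has a member. -/
theorem IsKWiseIndependent.pos {k s N M : ℕ} {H : Fin s → Fin N → Fin M}
    (hH : IsKWiseIndependent k H) (hN : 0 < N) (hM : 0 < M) : 0 < s := by
  rcases Nat.eq_zero_or_pos s with rfl | hs
  · have h1 := hH.1 ⟨0, hN⟩ ⟨0, hM⟩
    have h2 : (0 : ℝ) < 1 / M := by positivity
    rw [← h1, hashProb] at h2
    simp at h2
  · exact hs

theorem mainTheorem3 :
    -- there are 101-wise independent families of the required sizes
    (∃ c : ℕ, ∀ n : ℕ, 1 ≤ n → ∃ (s N M : ℕ) (H : Fin s → Fin N → Fin M),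
      HashSizes c n s N M ∧ IsKWiseIndependent 101 H) ∧
    -- from every such family a good function is found in `R = O(1)` rounds, with messages of
    -- `O(log n)` bits, and at the end every network node knows (the index of) the same function
    ∃ C₀ : ℝ, ∀ c : ℕ, ∃ B R : ℕ,
      ∀ (n s N M : ℕ) (H : Fin s → Fin N → Fin M) (x C : ℝ) (Color : Type*),
        1 ≤ n → ∀ hs : HashSizes c n s N M, IsKWiseIndependent 101 H →
        0 ≤ x → x ≤ 0.9 → C₀ ≤ C →
        ∃ A : CliqueAlgorithm n (B * Nat.clog 2 n) (NodeInput n Color) (Fin s),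
          ∀ G : PaletteGraph n Color, ∃ σ : Fin s,
            (∀ v : Fin n, A.run R G.nodeInput v = σ) ∧
            ∑ v ∈ G.deferred C hs.le_domain (H σ), (G.deg v : ℝ) ^ (x + 0.1) ≤
              C * n + 2 * ∑ v ∈ G.verts, (G.deg v : ℝ) ^ x := by
  -- a node `v` with `2 * 10 ^ 10 ≤ p(v) < 1.1 * d(v)` has `10 ^ 10 ≤ d(v)`, which is large enough
  -- for Chebyshev's inequality
  refine ⟨exists_hash_family, 2 * 10 ^ 10, fun c => ⟨c + 2, 1 + 2 * c, ?_⟩⟩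
  intro n s N M H x C Color hn hs hH hx0 hx hC
  have hs0 : 0 < s := hH.pos (hn.trans hs.le_domain) (hn.trans hs.le_range)
  have hb : n ^ (c + 2) ≤ 2 ^ ((c + 2) * Nat.clog 2 n) := by
    rw [mul_comm, pow_mul]
    exact Nat.pow_le_pow_left (Nat.le_pow_clog one_lt_two n) _
  have hb1 : n ≤ 2 ^ ((c + 2) * Nat.clog 2 n) := (Nat.le_self_pow (by omega) n).trans hb
  obtain ⟨σ, hσ, A, hA⟩ := Computes.exists_le_average hn hb hs0 hs.size_le
    (fun (G : PaletteGraph n Color) v τ => G.cost C x hs.le_domain (H τ) v)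
    (fun G v τ => (G.cost_le_deg hx0 hx hs.le_domain (H τ) v).trans_lt (G.deg_lt v))
    (PaletteGraph.computes_cost H C x hn hs.le_domain hb1)
  exact ⟨A, fun G => ⟨σ G, fun v => congrFun (hA G) v,
    G.sum_deferred_le hH (by norm_num) hs0 hs.le_domain hs.le_range hC hx0 hx (hσ G)⟩⟩
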